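/- Let $m>n\ge 1$. The blocking-variable weak pigeonhole principle $\mathrm{BPHP}^m_n$ is the MaxSAT instance whose hard clauses are the totality clauses $p_{i,1}\lor\dots\lor p_{i,n}\lor b_i$ for $1\le i\le m$, and the injectivity clauses $\lnot p_{i,j}\lor\lnot p_{k,j}\lor b_{i,k,j}$ for $1\le i<k\le m$ and $1\le j\le n$; its blocking variables are all the $b_i$ and all the $b_{i,k,j}$. The cost of a total assignment is the number of blocking variables that it sets to $1$, and the cost of an instance is the minimum cost of a total assignment satisfying all its hard clauses. A substitution $\sigma$ maps each variable to $0$, $1$ or a literal; $\Gamma{\upharpoonright}_\sigma$ is the formula $\Gamma$ restricted by $\sigma$, with satisfied (including tautological) clauses removed; for a non-tautological clause $C$, $\overline C$ is the partial assignment falsifying exactly the literals of $C$. We write $\Gamma\vdash_1\Delta$ if, for each clause $D\in\Delta$, unit propagation on $\Gamma{\upharpoonright}_{\overline D}$ produces the empty clause. A non-tautological clause $C$ is cost-SR with respect to $\Gamma$, with witness $\sigma$, if $\Gamma{\upharpoonright}_{\overline C}\vdash_1(\Gamma\cup\{C\}){\upharpoonright}_\sigma$ and $\mathrm{cost}(\tau\circ\sigma)\le\mathrm{cost}(\tau)$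 for all total assignments $\tau\supseteq\overline C$. A cost-SR derivation from $\Gamma$ is a sequence of clauses $D_1,\dots,D_t$ in which each $D_i$ is in $\Gamma$, or is obtained from earlier clauses of the sequence by weakening or resolution, or has only variables of $\Gamma$, is cost-SR with respect to $\Gamma\cup\{D_1,\dots,D_{i-1}\}$, and is accompanied by a witness. The size of a derivation is the total number of its clauses, of literal occurrences in them, and of entries of the accompanying substitutions (one entry per variable of the instance). Theorem. There is a polynomial $P$ such that for all $m>n\ge 1$: the cost of $\mathrm{BPHP}^m_n$ is exactly $m-n$, and the cost-SR calculus proves this in polynomial size, that is, there is a cost-SR derivation from $\mathrm{BPHP}^m_n$ of size at most $P(m)$ that contains the unit clauses $b_1,\dots,b_{m-n}$ and the unit clauses $\lnot b$ for all the other blocking variables $b$, namely $\lnot b_i$ for $m-n<i\le m$ and $\lnot b_{i,k,j}$ for $1\le i<k\le m$ and $1\le j\le n$. -/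

import Mathlib

namespace CostSR

/-! Propositional logic: literals, clauses, formulas, substitutions -/

/-- A literal over the variables `V`: `(x, true)` is `x` and `(x, false)` is `¬x`. -/
abbrev Literal (V : Type*) := V × Bool

/-- A clause is a finite set of literals (a disjunction). -/
abbrev Clause (V : Type*) := Finset (Literal V)

/-- A CNF formula, given by the set of its (hard) clauses. -/
abbrev CNF (V : Type*) := Finset (Clause V)

/-- What a substitution may assign to a variable: a Boolean constant (`Sum.inl`)
or a literal (`Sum.inr`). -/
abbrev Value (V : Type*) := Bool ⊕ Literal V

/-- A substitution maps every variable to `0`, `1` or a literal. -/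
abbrev Subst (V : Type*) := V → Value V

section Logic

variable {V : Type*} [DecidableEq V]

/-- The complementary literal. -/
def Literal.neg (l : Literal V) : Literal V := (l.1, !l.2)

/-- Negation of constants and literals. -/
def Value.neg : Value V → Value V
  | Sum.inl c => Sum.inl (!c)
  | Sum.inr l => Sum.inr (Literal.neg l)

/-- The extension of a substitution to literals, `σ(¬x) = ¬σ(x)`. -/
def Subst.onLit (σ : Subst V) (l : Literal V) : Value V :=
  if l.2 then σ l.1 else Value.neg (σ l.1)

/-- A clause is tautological if it contains a literal and its complement. -/
def IsTautology (C : Clause V) : Prop := ∃ l ∈ C, Literal.neg l ∈ C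

instance (C : Clause V) : Decidable (IsTautology C) :=
  inferInstanceAs (Decidable (∃ l ∈ C, Literal.neg l ∈ C))

/-- The literals of `⋁ σ(l)`, for `l ∈ C`, that remain after deleting the constants; this is
the restricted clause `C↾σ` whenever no literal of `C` is mapped to `1`. -/
def restrictClause (σ : Subst V) (C : Clause V) : Clause V :=
  C.biUnion fun l =>
    match σ.onLit l with
    | Sum.inl _ => ∅
    | Sum.inr l' => {l'}

/-- `σ ⊨ C`: some literal of `C` is mapped to `1`, or `C↾σ` is tautological. -/
def Satisfies (σ : Subst V) (C : Clause V) : Prop :=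
  (∃ l ∈ C, σ.onLit l = Sum.inl true) ∨ IsTautology (restrictClause σ C)

instance (σ : Subst V) (C : Clause V) : Decidable (Satisfies σ C) :=
  inferInstanceAs (Decidable ((∃ l ∈ C, σ.onLit l = Sum.inl true) ∨
    IsTautology (restrictClause σ C)))

/-- `Γ↾σ`: the restrictions of the clauses of `Γ` that `σ` does not satisfy. -/
def restrict (Γ : CNF V) (σ : Subst V) : CNF V :=
  (Γ.filter fun C => ¬ Satisfies σ C).image (restrictClause σ)

/-- The partial assignment `¬C` that falsifies all literals of the (non-tautological)
clause `C` and leaves the other variables unassigned. -/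
def negAssign (C : Clause V) : Subst V := fun x =>
  if (x, true) ∈ C then Sum.inl false
  else if (x, false) ∈ C then Sum.inl true
  else Sum.inr (x, true)

/-- The variables of a clause. -/
def clauseVars (C : Clause V) : Finset V := C.image Prod.fst

/-- The variables of a formula. -/
def cnfVars (Γ : CNF V) : Finset V := Γ.biUnion clauseVars

/-! Unit propagation -/

/-- Remove the clauses that contain `l`, and remove the complement of `l` from the others. -/
def propagate (Γ : CNF V) (l : Literal V) : CNF V :=
  (Γ.filter fun C => l ∉ C).image fun C => C.erase (Literal.neg l)

/-- One round of unit propagation. -/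
def UnitStep (Γ Γ' : CNF V) : Prop :=
  ∃ l : Literal V, {l} ∈ Γ ∧ Γ' = propagate Γ l

/-- Unit propagation on `Γ` produces the empty clause (which is never removed again). -/
def UnitRefutes (Γ : CNF V) : Prop :=
  ∃ Γ' : CNF V, Relation.ReflTransGen UnitStep Γ Γ' ∧ ∅ ∈ Γ'

/-- `Γ ⊢₁ C`, for a single clause `C`. -/
def UnitImplies (Γ : CNF V) (C : Clause V) : Prop :=
  UnitRefutes (restrict Γ (negAssign C))

/-- `Γ ⊢₁ Δ`, for a formula `Δ`. -/
def UnitImpliesAll (Γ Δ : CNF V) : Prop := ∀ D ∈ Δ, UnitImplies Γ D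

/-! Total assignments and cost -/

/-- The value of a constant or literal under a total assignment. -/
def evalValue (τ : V → Bool) : Value V → Bool
  | Sum.inl c => c
  | Sum.inr l => if l.2 then τ l.1 else !τ l.1

/-- The total assignment `τ ∘ σ`. -/
def compAssign (τ : V → Bool) (σ : Subst V) : V → Bool := fun x => evalValue τ (σ x)

/-- The total assignment `τ` extends `¬C`, that is, `τ` falsifies every literal of `C`. -/
def ExtendsNeg (τ : V → Bool) (C : Clause V) : Prop :=
  ∀ l ∈ C, evalValue τ (Sum.inr l) = false

/-- The total assignment `τ` satisfies every clause of `Γ`. -/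
def SatisfiesCNF (τ : V → Bool) (Γ : CNF V) : Prop :=
  ∀ C ∈ Γ, ∃ l ∈ C, evalValue τ (Sum.inr l) = true

/-- The number of blocking variables that `τ` sets to true. -/
def assignCost (B : Finset V) (τ : V → Bool) : ℕ := (B.filter fun b => τ b = true).card

/-- The minimum of `assignCost B α` over the total assignments `α` that satisfy `Γ` exists
and equals `k`. -/
def HasCost (B : Finset V) (Γ : CNF V) (k : ℕ) : Prop :=
  IsLeast {c | ∃ α : V → Bool, SatisfiesCNF α Γ ∧ assignCost B α = c} k

/-! The cost-SR calculus -/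

/-- The substitution `σ` witnesses that `C` is cost substitution redundant with respect to
`Γ`, for the set `B` of blocking variables. -/
def IsCostSRWitness (B : Finset V) (Γ : CNF V) (C : Clause V) (σ : Subst V) : Prop :=
  ¬ IsTautology C ∧
  UnitImpliesAll (restrict Γ (negAssign C)) (restrict (insert C Γ) σ) ∧
  ∀ τ : V → Bool, ExtendsNeg τ C → assignCost B (compAssign τ σ) ≤ assignCost B τ

/-- `D` follows from clauses in `prev` by weakening or by resolution on a variable. -/
def ResolutionInference (prev : List (Clause V)) (D : Clause V) : Prop :=
  (∃ A ∈ prev, A ⊆ D) ∨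
  ∃ (A A' : Clause V) (x : V),
    insert (x, true) A ∈ prev ∧ insert (x, false) A' ∈ prev ∧ D = A ∪ A'

/-- A line of a cost-SR derivation: a clause and, if the line is obtained by the cost-SR
rule, the witnessing substitution that comes with it. -/
structure Line (V : Type*) where
  clause : Clause V
  witness : Option (Subst V)

/-- The line `L` is justified, when the clauses `prev` have been derived from `Γ` before. -/
def Justified (B : Finset V) (Γ : CNF V) (prev : List (Clause V)) (L : Line V) : Prop :=
  match L.witness with
  | none => L.clause ∈ Γ ∨ ResolutionInference prev L.clause
  | some σ => IsCostSRWitness B (Γ ∪ prev.toFinset) L.clause σ ∧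
      clauseVars L.clause ⊆ cnfVars Γ

/-- `π` is a derivation in the cost-SR calculus from the instance with hard clauses `Γ` and
blocking variables `B`. -/
inductive IsDerivation (B : Finset V) (Γ : CNF V) : List (Line V) → Prop
  | nil : IsDerivation B Γ []
  | snoc (π : List (Line V)) (L : Line V) :
      IsDerivation B Γ π → Justified B Γ (π.map Line.clause) L → IsDerivation B Γ (π ++ [L])

/-- The size of a line: one, plus the number of literals of its clause, plus, for the cost-SR
rule, the number of entries of the table of the substitution. -/
def Line.size [Fintype V] (L : Line V) : ℕ :=
  1 + L.clause.card + (match L.witness with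
    | none => 0
    | some _ => Fintype.card V)

/-- The size of a derivation. It bounds the number of lines. -/
def derivationSize [Fintype V] (π : List (Line V)) : ℕ := (π.map Line.size).sum

/-- The clause `C` belongs to `Γ` or is a line of `π`. -/
def Derives (Γ : CNF V) (π : List (Line V)) (C : Clause V) : Prop :=
  C ∈ Γ ∨ C ∈ π.map Line.clause

/-- `π` is a cost-SR proof that the cost is `k`, which identifies `S` as the set of the `k`
blocking variables to be set to true: it derives the unit clauses `b` for `b ∈ S`, and `¬b`
for all other blocking variables `b`. -/
def IsCostProof (B : Finset V) (Γ : CNF V) (k : ℕ) (S : Finset V) (π : List (Line V)) : Prop :=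
  IsDerivation B Γ π ∧ S ⊆ B ∧ S.card = k ∧
  (∀ b ∈ S, Derives Γ π {(b, true)}) ∧
  (∀ b ∈ B, b ∉ S → Derives Γ π {(b, false)})

end Logic

/-! The weak pigeonhole principle with blocking variables -/

/-- The variables of the principle with `m` pigeons and `n` holes: `p i j`, `b i`, and
`b i k j` for `i < k`. -/
abbrev PHPVar (m n : ℕ) :=
  (Fin m × Fin n) ⊕ (Fin m ⊕ ({q : Fin m × Fin m // q.1 < q.2} × Fin n))

section PHP

variable {m n : ℕ}

instance : DecidableEq (PHPVar m n) :=
  inferInstanceAs (DecidableEq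
    ((Fin m × Fin n) ⊕ (Fin m ⊕ ({q : Fin m × Fin m // q.1 < q.2} × Fin n))))

/-- Pigeon `i` flies into hole `j`. -/
def flies (i : Fin m) (j : Fin n) : PHPVar m n := Sum.inl (i, j)

/-- The blocking variable `b i` of the totality clause of pigeon `i`. -/
def blockTot (i : Fin m) : PHPVar m n := Sum.inr (Sum.inl i)

/-- The blocking variable `b i k j` of an injectivity clause, where `q = (i, k)`, `i < k`. -/
def blockInj (q : {q : Fin m × Fin m // q.1 < q.2}) (j : Fin n) : PHPVar m n :=
  Sum.inr (Sum.inr (q, j))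

/-- The clause `p i 1 ∨ ⋯ ∨ p i n ∨ b i`. -/
def totClause (i : Fin m) : Clause (PHPVar m n) :=
  insert (blockTot i, true) (Finset.univ.image fun j : Fin n => (flies i j, true))

/-- The clause `¬p i j ∨ ¬p k j ∨ b i k j`, where `q = (i, k)`. -/
def injClause (q : {q : Fin m × Fin m // q.1 < q.2}) (j : Fin n) : Clause (PHPVar m n) :=
  {(flies q.1.1 j, false), (flies q.1.2 j, false), (blockInj q j, true)}

variable (m n)

/-- The hard clauses of the weak pigeonhole principle with blocking variables. -/
def BPHP : CNF (PHPVar m n) :=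
  (Finset.univ.image fun i : Fin m => totClause i) ∪
  (Finset.univ.image fun q : {q : Fin m × Fin m // q.1 < q.2} × Fin n => injClause q.1 q.2)

/-- All blocking variables `b i` and `b i k j`. -/
def BPHPBlocking : Finset (PHPVar m n) :=
  (Finset.univ.image fun i : Fin m => blockTot i) ∪
  (Finset.univ.image fun q : {q : Fin m × Fin m // q.1 < q.2} × Fin n => blockInj q.1 q.2)

/-- The first `m - n` of the blocking variables of the totality clauses. -/
def firstBlocking : Finset (PHPVar m n) :=
  (Finset.univ.filter fun i : Fin m => (i : ℕ) < m - n).image fun i => blockTot i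

end PHP

end CostSR

namespace CostSR

/-! ### Clauses, restrictions and a subsumption criterion for cost-SR witnesses. -/

section Generic

set_option linter.unusedSectionVars false

variable {V : Type*} [DecidableEq V]

/-! The derivation turns "without loss of generality" steps into cost-SR unit clauses. A collision
of pigeons `i < k` in hole `j` can be traded for evicting `i`: pay `b i`, save `b i k j`. This gives
every `¬b i k j` (`isCostSRWitness_evict`), and resolution then yields injectivity clauses without
blocking variables.

These clauses are symmetric under permuting pigeons, so the holes can be filled one by one, hole `j`
receiving the prescribed pigeon `a j`. If an unsettled pigeon `k` sits in hole `j`, exchanging it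
with `a j` costs nothing (`isCostSRWitness_exchange`); a pigeon already settled elsewhere can simply
leave (`isCostSRWitness_occupied`). With all others excluded, `a j` may be put into the hole
(`isCostSRWitness_occupy`). Once all holes are settled, `¬b (a j)` is free
(`isCostSRWitness_unblock`), and for the remaining pigeons resolution reduces the totality clause to
`b i`. Taking the last `n` pigeons as occupants leaves exactly the first `m - n` blocked.

Every witness is checked by subsumption alone (`unitImpliesAll_of_absorbs`), so no actual
propagation is needed. There are polynomially many lines, each with a table of polynomial size. The
value of the cost is proved semantically: an explicit assignment for the upper bound, and an
injective charging of pigeons to holes and violated clauses for the lower bound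
(`sub_le_assignCost`). -/

theorem Literal.neg_neg (l : Literal V) : Literal.neg (Literal.neg l) = l := by
  simp [Literal.neg]

theorem mem_restrictClause {σ : Subst V} {C : Clause V} {x : Literal V} :
    x ∈ restrictClause σ C ↔ ∃ y ∈ C, σ.onLit y = Sum.inr x := by
  simp only [restrictClause, Finset.mem_biUnion]
  refine exists_congr fun y => and_congr_right fun _ => ?_
  cases h : σ.onLit y <;> simp [eq_comm]

theorem negAssign_onLit_of_mem {C : Clause V} {l : Literal V} (hC : ¬ IsTautology C)
    (hl : l ∈ C) : Subst.onLit (negAssign C) l = Sum.inl false := by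
  obtain ⟨x, b⟩ := l
  have h : (x, !b) ∉ C := fun h => hC ⟨_, hl, h⟩
  cases b <;> simp_all [Subst.onLit, negAssign, Value.neg]

theorem negAssign_onLit_of_notMem {C : Clause V} {l : Literal V}
    (hl : l ∉ C) (hn : Literal.neg l ∉ C) :
    Subst.onLit (negAssign C) l = Sum.inr l := by
  obtain ⟨x, b⟩ := l
  cases b <;> simp_all [Subst.onLit, negAssign, Value.neg, Literal.neg]

theorem not_isTautology_singleton (l : Literal V) : ¬ IsTautology ({l} : Clause V) := by
  obtain ⟨x, b⟩ := l
  rintro ⟨y, hy, hn⟩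
  rw [Finset.mem_singleton] at hy hn
  subst hy
  cases b <;> simp [Literal.neg] at hn

/-- A clause is unit implied by any formula that contains a subclause of it. -/
theorem unitImplies_of_subset {Γ : CNF V} {E D : Clause V} (hE : E ∈ Γ) (hED : E ⊆ D)
    (hD : ¬ IsTautology D) : UnitImplies Γ D := by
  refine ⟨_, Relation.ReflTransGen.refl, ?_⟩
  have hfalse : ∀ x ∈ E, Subst.onLit (negAssign D) x = Sum.inl false :=
    fun x hx => negAssign_onLit_of_mem hD (hED hx)
  have hempty : restrictClause (negAssign D) E = ∅ := by
    refine Finset.eq_empty_of_forall_notMem fun x hx => ?_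
    obtain ⟨y, hy, h⟩ := mem_restrictClause.1 hx
    rw [hfalse y hy] at h
    exact absurd h (by simp)
  refine Finset.mem_image.2 ⟨E, Finset.mem_filter.2 ⟨hE, ?_⟩, hempty⟩
  rintro (⟨l, hl, h⟩ | ⟨l, hl, -⟩)
  · rw [hfalse l hl] at h
    exact absurd h (by simp)
  · rw [hempty] at hl
    exact absurd hl (by simp)

/-- Every clause of `insert {l} Γ` is satisfied by `σ`, or its restriction contains a clause
of `Γ` restricted by the falsity of `l`. -/
def Absorbs (Γ : CNF V) (l : Literal V) (σ : Subst V) (D : Clause V) : Prop :=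
  (∃ y ∈ D, σ.onLit y = Sum.inl true) ∨
    ∃ E ∈ Γ, Literal.neg l ∉ E ∧ ∀ x ∈ E, x = l ∨ ∃ y ∈ D, σ.onLit y = Sum.inr x

/-- Falsifying `l` deletes it from `E`, and what is left of `E` is a subclause of the restriction of
`D`. Falsifying that restriction makes it empty at once, so zero rounds of propagation suffice. -/
theorem unitImpliesAll_of_absorbs {Γ : CNF V} {l : Literal V} {σ : Subst V}
    (h : ∀ D ∈ insert {l} Γ, Absorbs Γ l σ D) :
    UnitImpliesAll (restrict Γ (negAssign {l})) (restrict (insert {l} Γ) σ) := by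
  intro R hR
  obtain ⟨D, hD, rfl⟩ := Finset.mem_image.1 hR
  obtain ⟨hD, hsat⟩ := Finset.mem_filter.1 hD
  have htaut : ¬ IsTautology (restrictClause σ D) := fun ht => hsat (Or.inr ht)
  rcases h D hD with h | ⟨E, hE, hl, hED⟩
  · exact absurd (Or.inl h) hsat
  have key : ∀ x ∈ E, ∀ v, Subst.onLit (negAssign {l}) x = v →
      v = Sum.inl false ∨ (v = Sum.inr x ∧ x ∈ restrictClause σ D) := by
    rintro x hx v rfl
    by_cases hxl : x = l
    · left
      subst hxl
      exact negAssign_onLit_of_mem (not_isTautology_singleton _) (Finset.mem_singleton_self _)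
    · right
      refine ⟨negAssign_onLit_of_notMem (by simpa using hxl) ?_,
        mem_restrictClause.2 ((hED x hx).resolve_left hxl)⟩
      rw [Finset.mem_singleton]
      rintro rfl
      exact hl (by rwa [Literal.neg_neg])
  have hsub : restrictClause (negAssign {l}) E ⊆ restrictClause σ D := by
    intro x hx
    obtain ⟨y, hy, hyx⟩ := mem_restrictClause.1 hx
    rcases key y hy _ hyx with h | ⟨h, h'⟩
    · exact absurd h (by simp)
    · rwa [Sum.inr.inj h]
  refine unitImplies_of_subset (Finset.mem_image_of_mem _ (Finset.mem_filter.2 ⟨hE, ?_⟩))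
    hsub htaut
  rintro (⟨y, hy, hyt⟩ | ⟨y, hy, hyn⟩)
  · rcases key y hy _ hyt with h | ⟨h, -⟩ <;> simp at h
  · exact htaut ⟨y, hsub hy, hsub hyn⟩

/-- The permutation says which true variable of `τ` pays for each true variable of `τ'`. It is
applied to the identity, to one transposition, and to a swap of two pigeons. -/
theorem assignCost_le_of_perm {B : Finset V} {τ τ' : V → Bool} (f : Equiv.Perm V)
    (h : ∀ b ∈ B, τ' b = true → f b ∈ B ∧ τ (f b) = true) :
    assignCost B τ' ≤ assignCost B τ := by
  refine Finset.card_le_card_of_injOn f (fun b hb => ?_) f.injective.injOn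
  obtain ⟨hb, ht⟩ := Finset.mem_filter.1 hb
  exact Finset.mem_filter.2 (h b hb ht)

/-- The substitution that makes the literal `l` true and fixes the other variables. -/
def setLit (l : Literal V) : Subst V := fun x => if x = l.1 then Sum.inl l.2 else Sum.inr (x, true)

theorem setLit_onLit_self (l : Literal V) : (setLit l).onLit l = Sum.inl true := by
  obtain ⟨x, b⟩ := l
  cases b <;> simp [Subst.onLit, setLit, Value.neg]

theorem onLit_of_fixed {σ : Subst V} {y : Literal V} (h : σ y.1 = Sum.inr (y.1, true)) :
    σ.onLit y = Sum.inr y := by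
  obtain ⟨x, b⟩ := y
  cases b <;> simp_all [Subst.onLit, Value.neg, Literal.neg]

theorem Literal.eq_or_eq_neg_of_fst_eq {l y : Literal V} (h : y.1 = l.1) :
    y = l ∨ y = Literal.neg l := by
  obtain ⟨x, b⟩ := l
  obtain ⟨x', b'⟩ := y
  cases b <;> cases b' <;> simp_all [Literal.neg]

theorem isCostSRWitness_of_absorbs {B : Finset V} {Γ : CNF V} {l : Literal V} {σ : Subst V}
    (h : ∀ D ∈ insert {l} Γ, Absorbs Γ l σ D)
    (hcost : ∀ τ : V → Bool, evalValue τ (Sum.inr l) = false →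
      assignCost B (compAssign τ σ) ≤ assignCost B τ) :
    IsCostSRWitness B Γ {l} σ :=
  ⟨not_isTautology_singleton l, unitImpliesAll_of_absorbs h,
    fun τ hτ => hcost τ (hτ l (Finset.mem_singleton_self l))⟩

/-- A relaxed pure literal rule: making `l` true only harms clauses that contain its complement, and
each of these has a subclause in `Γ` that avoids it. The condition `hl` keeps the cost from rising,
since a blocking variable may only be switched off. -/
theorem isCostSRWitness_setLit {B : Finset V} {Γ : CNF V} {l : Literal V}
    (hl : l.1 ∈ B → l.2 = false)
    (h : ∀ D ∈ Γ, Literal.neg l ∈ D → ∃ E ∈ Γ, E ⊆ D ∧ Literal.neg l ∉ E) :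
    IsCostSRWitness B Γ {l} (setLit l) := by
  have hfix : ∀ y : Literal V, y ≠ l → y ≠ Literal.neg l → (setLit l).onLit y = Sum.inr y := by
    intro y h1 h2
    refine onLit_of_fixed (if_neg fun hy => ?_)
    exact (Literal.eq_or_eq_neg_of_fst_eq hy).elim h1 h2
  refine isCostSRWitness_of_absorbs (fun D hD => ?_) fun τ hτ => ?_
  · by_cases hlD : l ∈ D
    · exact Or.inl ⟨l, hlD, setLit_onLit_self l⟩
    right
    rw [Finset.mem_insert] at hD
    have hDΓ : D ∈ Γ := hD.resolve_left fun h => hlD (h ▸ Finset.mem_singleton_self l)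
    obtain ⟨E, hE, hED, hlE⟩ : ∃ E ∈ Γ, E ⊆ D ∧ Literal.neg l ∉ E := by
      by_cases hn : Literal.neg l ∈ D
      · exact h D hDΓ hn
      · exact ⟨D, hDΓ, subset_rfl, hn⟩
    refine ⟨E, hE, hlE, fun x hx => Or.inr ⟨x, hED hx, hfix x ?_ ?_⟩⟩
    · rintro rfl
      exact hlD (hED hx)
    · rintro rfl
      exact hlE hx
  · refine assignCost_le_of_perm (Equiv.refl V) fun b hb ht => ⟨hb, ?_⟩
    by_cases hbl : b = l.1
    · subst hbl
      simp [compAssign, setLit, evalValue, hl hb] at ht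
    · simpa [compAssign, setLit, evalValue, hbl] using ht

/-! ### Building derivations while tracking their size. -/

variable [Fintype V]

/-- Some derivation of size at most `s` has exactly the clauses `F` as its lines. -/
def Reaches (B : Finset V) (Γ : CNF V) (s : ℕ) (F : CNF V) : Prop :=
  ∃ π : List (Line V), IsDerivation B Γ π ∧ (π.map Line.clause).toFinset = F ∧
    derivationSize π ≤ s

variable {B : Finset V} {Γ F : CNF V} {s : ℕ}

theorem reaches_empty : Reaches B Γ 0 ∅ := ⟨[], .nil, rfl, le_rfl⟩

theorem Reaches.mono {s' : ℕ} (h : Reaches B Γ s F) (hs : s ≤ s') : Reaches B Γ s' F := by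
  obtain ⟨π, h1, h2, h3⟩ := h
  exact ⟨π, h1, h2, h3.trans hs⟩

theorem Reaches.snoc (h : Reaches B Γ s F) (L : Line V) {K : ℕ} (hK : L.size ≤ K)
    (hL : ∀ prev : List (Clause V), prev.toFinset = F → Justified B Γ prev L) :
    Reaches B Γ (s + K) (insert L.clause F) := by
  obtain ⟨π, h1, h2, h3⟩ := h
  refine ⟨π ++ [L], .snoc π L h1 (hL _ h2), ?_, ?_⟩
  · rw [List.map_append, List.toFinset_append, h2]
    ext
    simp
  · simpa [derivationSize] using add_le_add h3 hK

theorem Reaches.axiomLine (h : Reaches B Γ s F) {C : Clause V} (hC : C ∈ Γ) {K : ℕ}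
    (hK : C.card + 1 ≤ K) : Reaches B Γ (s + K) (insert C F) :=
  h.snoc ⟨C, none⟩ (by simpa [Line.size, add_comm] using hK) fun _ _ => Or.inl hC

theorem Reaches.resolve (h : Reaches B Γ s F) {A A' : Clause V} {x : V}
    (hA : insert (x, true) A ∈ F) (hA' : insert (x, false) A' ∈ F) {K : ℕ}
    (hK : (A ∪ A').card + 1 ≤ K) : Reaches B Γ (s + K) (insert (A ∪ A') F) := by
  refine h.snoc ⟨A ∪ A', none⟩ (by simpa [Line.size, add_comm] using hK) fun prev hp => ?_
  refine Or.inr (Or.inr ⟨A, A', x, ?_, ?_, rfl⟩)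
  · rwa [← hp, List.mem_toFinset] at hA
  · rwa [← hp, List.mem_toFinset] at hA'

theorem Reaches.costSR (h : Reaches B Γ s F) (hΓ : Γ ⊆ F) {l : Literal V} {σ : Subst V}
    (hl : l.1 ∈ cnfVars Γ) (hσ : IsCostSRWitness B F {l} σ) :
    Reaches B Γ (s + (Fintype.card V + 2)) (insert {l} F) := by
  refine h.snoc ⟨{l}, some σ⟩ ?_ fun prev hp => ⟨?_, ?_⟩
  · simp [Line.size]
    omega
  · rwa [hp, Finset.union_eq_right.2 hΓ]
  · simpa [clauseVars] using hl

/-- Cost-SR redundancy is not monotone in the formula, so each step has to know exactly which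
members `T` of the family are already present. The order is arbitrary, hence the quantification over
all `T`. -/
theorem Reaches.family {ι : Type*} [DecidableEq ι] (c : ι → Clause V) (S : Finset ι) {K : ℕ}
    (h : Reaches B Γ s F)
    (hstep : ∀ T ⊆ S, ∀ x ∈ S, x ∉ T → ∀ s', Reaches B Γ s' (F ∪ T.image c) →
      Reaches B Γ (s' + K) (insert (c x) (F ∪ T.image c))) :
    Reaches B Γ (s + S.card * K) (F ∪ S.image c) := by
  suffices H : ∀ T ⊆ S, Reaches B Γ (s + T.card * K) (F ∪ T.image c) from H S subset_rfl
  intro T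
  induction T using Finset.induction_on with
  | empty => intro _; simpa using h
  | insert x T hx ih =>
    intro hT
    rw [Finset.insert_subset_iff] at hT
    have := hstep T hT.2 x hT.1 hx _ (ih hT.2)
    rw [Finset.card_insert_of_notMem hx, Finset.image_insert, Finset.union_insert, add_mul,
      one_mul, ← add_assoc]
    exact this

/-- Resolving a clause with negated unit clauses removes the corresponding literals. -/
theorem Reaches.resolve_units (h : Reaches B Γ s F) (A : Clause V) (X : Finset V) {K : ℕ}
    (hK : A.card + X.card + 1 ≤ K)
    (hA : A ∪ X.image (fun x => (x, true)) ∈ F) (hX : ∀ x ∈ X, {(x, false)} ∈ F) :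
    ∃ F', F ⊆ F' ∧ A ∈ F' ∧ Reaches B Γ (s + X.card * K) F' := by
  induction X using Finset.induction_on generalizing s F with
  | empty => exact ⟨F, subset_rfl, by simpa using hA, by simpa using h⟩
  | insert x X hx ih =>
    rw [Finset.card_insert_of_notMem hx] at hK
    rw [Finset.image_insert, Finset.union_insert] at hA
    have hcard : (A ∪ X.image (fun x => (x, true)) ∪ ∅).card + 1 ≤ K := by
      rw [Finset.union_empty]
      have h1 := Finset.card_union_le A (X.image (fun x => (x, true)))
      have h2 : (X.image (fun x => (x, true))).card ≤ X.card := Finset.card_image_le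
      omega
    have hr := h.resolve (A' := ∅) hA (by simpa using hX x (Finset.mem_insert_self _ _)) hcard
    rw [Finset.union_empty] at hr
    obtain ⟨F', h1, h2, h3⟩ := ih hr (by omega) (Finset.mem_insert_self _ _) fun y hy =>
      Finset.mem_insert_of_mem (hX y (Finset.mem_insert_of_mem hy))
    refine ⟨F', (Finset.subset_insert _ _).trans h1, h2, ?_⟩
    rw [Finset.card_insert_of_notMem hx, add_mul, one_mul, add_comm (X.card * K), ← add_assoc]
    exact h3

end Generic

/-! ### Witnesses for the pigeonhole principle. -/

section Pigeons

variable {m n : ℕ}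

theorem mem_totClause {i : Fin m} {x : Literal (PHPVar m n)} :
    x ∈ totClause i ↔ x = (blockTot i, true) ∨ ∃ j, x = (flies i j, true) := by
  simp [totClause, eq_comm]

theorem mem_injClause {q : {q : Fin m × Fin m // q.1 < q.2}} {j : Fin n}
    {x : Literal (PHPVar m n)} :
    x ∈ injClause q j ↔ x = (flies q.1.1 j, false) ∨ x = (flies q.1.2 j, false) ∨
      x = (blockInj q j, true) := by
  simp [injClause]

theorem mem_BPHP {D : Clause (PHPVar m n)} :
    D ∈ BPHP m n ↔ (∃ i, D = totClause i) ∨ ∃ q j, D = injClause q j := by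
  simp only [BPHP, Finset.mem_union, Finset.mem_image, Finset.mem_univ, true_and, Prod.exists,
    eq_comm]

theorem inr_mem_blocking (v : Fin m ⊕ ({q : Fin m × Fin m // q.1 < q.2} × Fin n)) :
    (Sum.inr v : PHPVar m n) ∈ BPHPBlocking m n := by
  rcases v with i | ⟨q, j⟩ <;> simp [BPHPBlocking, blockTot, blockInj]

theorem flies_notMem_blocking (i : Fin m) (j : Fin n) : flies i j ∉ BPHPBlocking m n := by
  simp [BPHPBlocking, blockTot, blockInj, flies]

theorem flies_mem_cnfVars (i : Fin m) (j : Fin n) : flies i j ∈ cnfVars (BPHP m n) :=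
  Finset.mem_biUnion.2 ⟨totClause i, mem_BPHP.2 (Or.inl ⟨i, rfl⟩),
    Finset.mem_image.2 ⟨_, mem_totClause.2 (Or.inr ⟨j, rfl⟩), rfl⟩⟩

theorem blockTot_mem_cnfVars (i : Fin m) : blockTot i ∈ cnfVars (BPHP m n) :=
  Finset.mem_biUnion.2 ⟨totClause i, mem_BPHP.2 (Or.inl ⟨i, rfl⟩),
    Finset.mem_image.2 ⟨_, mem_totClause.2 (Or.inl rfl), rfl⟩⟩

theorem blockInj_mem_cnfVars (q : {q : Fin m × Fin m // q.1 < q.2}) (j : Fin n) :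
    blockInj q j ∈ cnfVars (BPHP m n) :=
  Finset.mem_biUnion.2 ⟨injClause q j, mem_BPHP.2 (Or.inr ⟨q, j, rfl⟩),
    Finset.mem_image.2 ⟨_, mem_injClause.2 (Or.inr (Or.inr rfl)), rfl⟩⟩

/-- Remove pigeon `i` from all holes, at the price of `b i`, and repair one collision. -/
def evict (i : Fin m) (q : {q : Fin m × Fin m // q.1 < q.2}) (j : Fin n) : Subst (PHPVar m n)
  | Sum.inl (i', j') => if i' = i then Sum.inl false else Sum.inr (Sum.inl (i', j'), true)
  | Sum.inr (Sum.inl i') =>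
      if i' = i then Sum.inl true else Sum.inr (Sum.inr (Sum.inl i'), true)
  | Sum.inr (Sum.inr q') =>
      if q' = (q, j) then Sum.inl false else Sum.inr (Sum.inr (Sum.inr q'), true)

/-- A clause of `Γ` all of whose literals are fixed by the substitution is absorbed. -/
theorem absorbs_of_fixed {V : Type*} [DecidableEq V] {Γ : CNF V} {l : Literal V} {σ : Subst V}
    {D : Clause V} (hD : D ∈ Γ) (hl : Literal.neg l ∉ D)
    (h : ∀ x ∈ D, σ x.1 = Sum.inr (x.1, true)) : Absorbs Γ l σ D :=
  Or.inr ⟨D, hD, hl, fun x hx => Or.inr ⟨x, hx, onLit_of_fixed (h x hx)⟩⟩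

/-- Every hard clause about the evicted pigeon is satisfied, by its blocking variable or by its
absence from a hole. All other clauses are left unchanged, including the earlier units because `(q,
j) ∉ T`. -/
theorem isCostSRWitness_evict (T : Finset ({q : Fin m × Fin m // q.1 < q.2} × Fin n))
    (q : {q : Fin m × Fin m // q.1 < q.2}) (j : Fin n) (hT : (q, j) ∉ T) :
    IsCostSRWitness (BPHPBlocking m n)
      (BPHP m n ∪ T.image fun r => {(blockInj r.1 r.2, false)}) {(blockInj q j, false)}
      (evict q.1.1 q j) := by
  refine isCostSRWitness_of_absorbs (fun D hD => ?_) fun τ hτ => ?_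
  · rw [Finset.mem_insert] at hD
    rcases hD with rfl | hD
    · exact Or.inl ⟨_, Finset.mem_singleton_self _,
        by simp [Subst.onLit, evict, blockInj, Value.neg]⟩
    have hD' := hD
    rw [Finset.mem_union, mem_BPHP, Finset.mem_image] at hD
    rcases hD with (⟨i, rfl⟩ | ⟨q', j', rfl⟩) | ⟨r, hr, rfl⟩
    · by_cases hi : i = q.1.1
      · exact Or.inl ⟨_, mem_totClause.2 (Or.inl rfl),
          by simp [Subst.onLit, evict, blockTot, hi]⟩
      · refine absorbs_of_fixed hD' ?_ fun x hx => ?_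
        · simp [mem_totClause, Literal.neg, blockInj, blockTot, flies]
        · rcases mem_totClause.1 hx with rfl | ⟨j', rfl⟩ <;> simp [evict, blockTot, flies, hi]
    · by_cases h1 : q'.1.1 = q.1.1
      · exact Or.inl ⟨_, mem_injClause.2 (Or.inl rfl),
          by simp [Subst.onLit, evict, flies, h1, Value.neg]⟩
      by_cases h2 : q'.1.2 = q.1.1
      · exact Or.inl ⟨_, mem_injClause.2 (Or.inr (Or.inl rfl)),
          by simp [Subst.onLit, evict, flies, h2, Value.neg]⟩
      have hq : q' ≠ q := fun h => h1 (by rw [h])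
      refine absorbs_of_fixed hD' ?_ fun x hx => ?_
      · simp [mem_injClause, Literal.neg, blockInj, flies, hq.symm]
      · rcases mem_injClause.1 hx with rfl | rfl | rfl <;>
          simp [evict, blockInj, flies, h1, h2, hq]
    · have hne : r ≠ (q, j) := fun h => hT (h ▸ hr)
      refine absorbs_of_fixed hD' ?_ fun x hx => ?_
      · simp [Literal.neg]
      · rw [Finset.mem_singleton] at hx
        subst hx
        simp [evict, blockInj, hne]
  · have hτ : τ (blockInj q j) = true := by simpa [evalValue] using hτ
    -- `τ` falsifies `¬b i k j`, so this variable is true in `τ` and pays for the new `b i`.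
    refine assignCost_le_of_perm (Equiv.swap (blockTot q.1.1) (blockInj q j)) fun b hb ht => ?_
    rcases b with ⟨i, j'⟩ | i | r
    · exact absurd hb (flies_notMem_blocking i j')
    · by_cases hi : i = q.1.1
      · rw [hi, ← blockTot, Equiv.swap_apply_left]
        exact ⟨inr_mem_blocking _, hτ⟩
      · rw [Equiv.swap_apply_of_ne_of_ne (by simpa [blockTot] using hi) (by simp [blockInj])]
        exact ⟨hb, by simpa [compAssign, evict, hi, evalValue] using ht⟩
    · by_cases hr : r = (q, j)
      · simp [compAssign, evict, hr, evalValue] at ht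
      · rw [Equiv.swap_apply_of_ne_of_ne (by simp [blockTot]) (by simpa [blockInj] using hr)]
        exact ⟨hb, by simpa [compAssign, evict, hr, evalValue] using ht⟩

/-- Pigeons `i` and `k` do not share hole `j`. -/
def pairClause (i k : Fin m) (j : Fin n) : Clause (PHPVar m n) :=
  {(flies i j, false), (flies k j, false)}

variable (m n) in
/-- The hard clauses, the negations of the blocking variables of the injectivity clauses,
and the resulting injectivity clauses without blocking variables. -/
def injectiveBPHP : CNF (PHPVar m n) :=
  (BPHP m n ∪ Finset.univ.image fun r : {q : Fin m × Fin m // q.1 < q.2} × Fin n =>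
    {(blockInj r.1 r.2, false)}) ∪
  Finset.univ.image fun r : {q : Fin m × Fin m // q.1 < q.2} × Fin n =>
    pairClause r.1.1.1 r.1.1.2 r.2

theorem mem_injectiveBPHP {D : Clause (PHPVar m n)} :
    D ∈ injectiveBPHP m n ↔ (∃ i, D = totClause i) ∨ (∃ q j, D = injClause q j) ∨
      (∃ q j, D = {(blockInj q j, false)}) ∨ ∃ i k j, i ≠ k ∧ D = pairClause i k j := by
  simp only [injectiveBPHP, Finset.mem_union, mem_BPHP, Finset.mem_image, Finset.mem_univ,
    true_and, Prod.exists, or_assoc]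
  refine or_congr_right (or_congr_right (or_congr (by simp only [eq_comm]) ⟨?_, ?_⟩))
  · rintro ⟨q, j, rfl⟩
    exact ⟨_, _, j, q.2.ne, rfl⟩
  · rintro ⟨i, k, j, hik, rfl⟩
    rcases hik.lt_or_gt with h | h
    · exact ⟨⟨(i, k), h⟩, j, rfl⟩
    · exact ⟨⟨(k, i), h⟩, j, Finset.pair_comm _ _⟩

/-- The unit clauses that put pigeon `a j` into hole `j` and the other pigeons elsewhere. -/
def holeUnits (a : Fin n → Fin m) (j : Fin n) : CNF (PHPVar m n) :=
  insert {(flies (a j) j, true)} ((Finset.univ.erase (a j)).image fun k => {(flies k j, false)})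

/-- `injectiveBPHP` together with the contents of the holes in `J`. -/
def settled (a : Fin n → Fin m) (J : Finset (Fin n)) : CNF (PHPVar m n) :=
  injectiveBPHP m n ∪ J.biUnion (holeUnits a)

theorem mem_settled {a : Fin n → Fin m} {J : Finset (Fin n)} {D : Clause (PHPVar m n)} :
    D ∈ settled a J ↔ (∃ i, D = totClause i) ∨ (∃ q j, D = injClause q j) ∨
      (∃ q j, D = {(blockInj q j, false)}) ∨ (∃ i k j, i ≠ k ∧ D = pairClause i k j) ∨
      (∃ j ∈ J, D = {(flies (a j) j, true)}) ∨
      ∃ j ∈ J, ∃ k, k ≠ a j ∧ D = {(flies k j, false)} := by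
  simp only [settled, Finset.mem_union, mem_injectiveBPHP, Finset.mem_biUnion, holeUnits,
    Finset.mem_insert, Finset.mem_image, Finset.mem_erase, Finset.mem_univ, and_true, or_assoc,
    and_or_left, exists_or]
  simp only [eq_comm]

theorem settled_insert (a : Fin n → Fin m) (J : Finset (Fin n)) (j : Fin n) :
    settled a (insert j J) = insert {(flies (a j) j, true)} (settled a J ∪
      (Finset.univ.erase (a j)).image fun k => {(flies k j, false)}) := by
  rw [settled, settled, Finset.biUnion_insert, holeUnits, Finset.insert_union,
    Finset.union_insert, Finset.union_assoc, Finset.union_comm (Finset.biUnion _ _)]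

theorem BPHP_subset_settled (a : Fin n → Fin m) (J : Finset (Fin n)) :
    BPHP m n ⊆ settled a J := fun D hD => by
  rw [mem_BPHP] at hD
  rw [mem_settled]
  exact hD.imp_right Or.inl

/-- Exchange the pigeons `k` and `a`, and put `a` into hole `j`. -/
def exchange (k a : Fin m) (j : Fin n) : Subst (PHPVar m n)
  | Sum.inl (i, j') =>
      if i = a ∧ j' = j then Sum.inl true else Sum.inr (flies (Equiv.swap k a i) j', true)
  | Sum.inr (Sum.inl i) => Sum.inr (blockTot (Equiv.swap k a i), true)
  | Sum.inr (Sum.inr q) => Sum.inr (Sum.inr (Sum.inr q), true)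

/-- Neither `k` nor `a j` is settled in a hole of `J`, so exchanging them maps the units for those
holes to such units. Forcing `a j` into hole `j` is consistent since, under `p k j`, its counterpart
`k` was there. -/
theorem isCostSRWitness_exchange {a : Fin n → Fin m} (ha : Function.Injective a)
    {J : Finset (Fin n)} {j : Fin n} (hj : j ∉ J) {T : Finset (Fin m)} (hT : a j ∉ T)
    {k : Fin m} (hk : k ∉ T) (hka : k ≠ a j) (hkJ : ∀ j' ∈ J, k ≠ a j') :
    IsCostSRWitness (BPHPBlocking m n)
      (settled a J ∪ T.image fun k => {(flies k j, false)}) {(flies k j, false)}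
      (exchange k (a j) j) := by
  -- The exchange does not permute the variables `b i k j`, so injectivity clauses are absorbed by
  -- pair clauses, which carry none. The literal of `a j` in hole `j` vanishes under the
  -- substitution; its expected image is `¬p k j`, which `Absorbs` allows as the literal `l`.
  have hpair : ∀ D i i' j', i ≠ i' → (flies i j', false) ∈ D → (flies i' j', false) ∈ D →
      Absorbs (settled a J ∪ T.image fun k => {(flies k j, false)}) (flies k j, false)
        (exchange k (a j) j) D := by
    intro D i i' j' hii h1 h2
    have hlit : ∀ i, (flies i j', false) ∈ D →
        ((flies (Equiv.swap k (a j) i) j', false) : Literal (PHPVar m n)) = (flies k j, false) ∨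
        ∃ y ∈ D, (exchange k (a j) j).onLit y
          = Sum.inr (flies (Equiv.swap k (a j) i) j', false) := by
      intro i hi
      by_cases h : i = a j ∧ j' = j
      · left
        rw [h.1, h.2, Equiv.swap_apply_right]
      · right
        exact ⟨_, hi, by simp [Subst.onLit, exchange, flies, h, Value.neg, Literal.neg]⟩
    refine Or.inr ⟨pairClause (Equiv.swap k (a j) i) (Equiv.swap k (a j) i') j',
      Finset.mem_union_left _ (mem_settled.2 ?_), by simp [pairClause, Literal.neg], ?_⟩
    · exact Or.inr (Or.inr (Or.inr (Or.inl ⟨_, _, j', (Equiv.injective _).ne hii, rfl⟩)))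
    · intro x hx
      rw [pairClause, Finset.mem_insert, Finset.mem_singleton] at hx
      rcases hx with rfl | rfl
      · exact hlit i h1
      · exact hlit i' h2
  refine isCostSRWitness_of_absorbs (fun D hD => ?_) fun τ hτ => ?_
  · rw [Finset.mem_insert] at hD
    rcases hD with rfl | hD
    · refine Or.inr ⟨pairClause k (a j) j, Finset.mem_union_left _ (mem_settled.2 ?_),
        by simp [pairClause, Literal.neg], ?_⟩
      · exact Or.inr (Or.inr (Or.inr (Or.inl ⟨_, _, j, hka, rfl⟩)))
      · intro x hx
        rw [pairClause, Finset.mem_insert, Finset.mem_singleton] at hx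
        rcases hx with rfl | rfl
        · exact Or.inl rfl
        · exact Or.inr ⟨_, Finset.mem_singleton_self _,
            by simp [Subst.onLit, exchange, flies, hka, Value.neg, Literal.neg]⟩
    have hD' := hD
    rw [Finset.mem_union, mem_settled, Finset.mem_image] at hD
    rcases hD with (⟨i, rfl⟩ | ⟨q, j', rfl⟩ | ⟨q, j', rfl⟩ | ⟨i, i', j', hii, rfl⟩ |
      ⟨j', hj', rfl⟩ | ⟨j', hj', i, hi, rfl⟩) | ⟨i, hi, rfl⟩
    · by_cases hi : i = a j
      · exact Or.inl ⟨_, mem_totClause.2 (Or.inr ⟨j, rfl⟩),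
          by simp [Subst.onLit, exchange, flies, hi]⟩
      · refine Or.inr ⟨totClause (Equiv.swap k (a j) i), Finset.mem_union_left _
          (mem_settled.2 (Or.inl ⟨_, rfl⟩)), ?_, fun x hx => Or.inr ?_⟩
        · have : k ≠ Equiv.swap k (a j) i := fun h => hi (by
            rw [← Equiv.swap_apply_left k (a j)]
            nth_rw 2 [h]
            rw [Equiv.swap_apply_self])
          simp [mem_totClause, Literal.neg, flies, blockTot, this]
        · rcases mem_totClause.1 hx with rfl | ⟨j', rfl⟩
          · exact ⟨_, mem_totClause.2 (Or.inl rfl), by simp [Subst.onLit, exchange, blockTot]⟩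
          · exact ⟨_, mem_totClause.2 (Or.inr ⟨j', rfl⟩),
              by simp [Subst.onLit, exchange, flies, hi]⟩
    · exact hpair _ _ _ j' q.2.ne (mem_injClause.2 (Or.inl rfl))
        (mem_injClause.2 (Or.inr (Or.inl rfl)))
    · refine absorbs_of_fixed hD' (by simp [Literal.neg]) fun x hx => ?_
      rw [Finset.mem_singleton] at hx
      subst hx
      rfl
    · exact hpair _ _ _ j' hii (by simp [pairClause]) (by simp [pairClause])
    · have hjj : j' ≠ j := fun h => hj (h ▸ hj')
      refine absorbs_of_fixed hD' ?_ fun x hx => ?_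
      · simp [Literal.neg, flies, hjj.symm]
      · rw [Finset.mem_singleton] at hx
        subst hx
        have := Equiv.swap_apply_of_ne_of_ne (hkJ j' hj').symm (ha.ne hjj)
        simp [exchange, flies, hjj, this]
    · have hjj : j' ≠ j := fun h => hj (h ▸ hj')
      have hfix := Equiv.swap_apply_of_ne_of_ne (hkJ j' hj').symm (ha.ne hjj)
      refine Or.inr ⟨{(flies (Equiv.swap k (a j) i) j', false)}, Finset.mem_union_left _
        (mem_settled.2 ?_), by simp [Literal.neg], fun x hx => Or.inr ?_⟩
      · refine Or.inr (Or.inr (Or.inr (Or.inr (Or.inr ⟨j', hj', _, fun h => hi ?_, rfl⟩))))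
        rw [← hfix] at h
        exact Equiv.injective _ h
      · rw [Finset.mem_singleton] at hx
        subst hx
        exact ⟨_, Finset.mem_singleton_self _,
          by simp [Subst.onLit, exchange, flies, hjj, Value.neg, Literal.neg]⟩
    · have h1 : i ≠ k := fun h => hk (h ▸ hi)
      have h2 : i ≠ a j := fun h => hT (h ▸ hi)
      refine absorbs_of_fixed hD' (by simp [Literal.neg]) fun x hx => ?_
      rw [Finset.mem_singleton] at hx
      subst hx
      simp [exchange, flies, h2, Equiv.swap_apply_of_ne_of_ne h1 h2]
  · refine assignCost_le_of_perm (Equiv.sumCongr (Equiv.refl _)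
      (Equiv.sumCongr (Equiv.swap k (a j)) (Equiv.refl _))) fun b hb ht => ?_
    rcases b with ⟨i, j'⟩ | i | r
    · exact absurd hb (flies_notMem_blocking i j')
    · exact ⟨inr_mem_blocking _, show τ (Sum.inr (Sum.inl (Equiv.swap k (a j) i))) = true by
        simpa [compAssign, exchange, evalValue, blockTot] using ht⟩
    · exact ⟨inr_mem_blocking _, show τ (Sum.inr (Sum.inr r)) = true by
        simpa [compAssign, exchange, evalValue] using ht⟩

/-- An exchange would disturb hole `j'`. It is not needed: the only clause wanting this pigeon in
hole `j` is its totality clause, subsumed by the unit for `j'`. -/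
theorem isCostSRWitness_occupied {a : Fin n → Fin m} {J : Finset (Fin n)} {j j' : Fin n} (hj : j ∉ J) (hj' : j' ∈ J) (T : Finset (Fin m)) :
    IsCostSRWitness (BPHPBlocking m n)
      (settled a J ∪ T.image fun k => {(flies k j, false)}) {(flies (a j') j, false)}
      (setLit (flies (a j') j, false)) := by
  refine isCostSRWitness_setLit (fun _ => rfl) fun D hD hlD => ?_
  have hjj : ∀ i ∈ J, i ≠ j := fun i hi h => hj (h ▸ hi)
  rw [Finset.mem_union, mem_settled, Finset.mem_image] at hD
  rcases hD with (⟨i, rfl⟩ | ⟨q, j', rfl⟩ | ⟨q, j', rfl⟩ | ⟨i, i', j', hii, rfl⟩ |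
      ⟨i, hi, rfl⟩ | ⟨j', hj', i, hi, rfl⟩) | ⟨i, hi, rfl⟩
  · have hi : a j' = i := by simpa [mem_totClause, Literal.neg, flies, blockTot] using hlD
    refine ⟨{(flies (a j') j', true)}, Finset.mem_union_left _ (mem_settled.2 ?_), ?_, ?_⟩
    · exact Or.inr (Or.inr (Or.inr (Or.inr (Or.inl ⟨j', hj', rfl⟩))))
    · rw [Finset.singleton_subset_iff, mem_totClause, hi]
      exact Or.inr ⟨j', rfl⟩
    · simp [Literal.neg, flies, (hjj j' hj').symm]
  · simp [mem_injClause, Literal.neg, flies, blockInj] at hlD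
  · simp [Literal.neg] at hlD
  · simp [pairClause, Literal.neg] at hlD
  · simp [Literal.neg, flies, (hjj i hi).symm] at hlD
  · simp [Literal.neg] at hlD
  · simp [Literal.neg] at hlD

/-- The clauses opposing the new unit are injectivity and pair clauses at hole `j`; each is subsumed
by the unit excluding the other pigeon. -/
theorem isCostSRWitness_occupy {a : Fin n → Fin m} {J : Finset (Fin n)} {j : Fin n}
    (hj : j ∉ J) :
    IsCostSRWitness (BPHPBlocking m n)
      (settled a J ∪ (Finset.univ.erase (a j)).image fun k => {(flies k j, false)})
      {(flies (a j) j, true)} (setLit (flies (a j) j, true)) := by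
  refine isCostSRWitness_setLit (fun h => absurd h (flies_notMem_blocking _ _)) fun D hD hlD => ?_
  have hunit : ∀ k, k ≠ a j → (flies k j, false) ∈ D → ∃ E ∈ settled a J ∪
      (Finset.univ.erase (a j)).image fun k => {(flies k j, false)},
      E ⊆ D ∧ Literal.neg (flies (a j) j, true) ∉ E := by
    intro k hk hkD
    refine ⟨{(flies k j, false)}, Finset.mem_union_right _ (Finset.mem_image.2
      ⟨k, by simpa using hk, rfl⟩), by simpa using hkD, by simp [Literal.neg, flies, hk.symm]⟩
  have hpair : ∀ i k j', i ≠ k → (flies i j', false) ∈ D → (flies k j', false) ∈ D →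
      (a j = i ∧ j = j' ∨ a j = k ∧ j = j') → ∃ E ∈ settled a J ∪
      (Finset.univ.erase (a j)).image fun k => {(flies k j, false)},
      E ⊆ D ∧ Literal.neg (flies (a j) j, true) ∉ E := by
    rintro i k j' hik hi hk (⟨rfl, rfl⟩ | ⟨rfl, rfl⟩)
    · exact hunit k hik.symm hk
    · exact hunit i hik hi
  rw [Finset.mem_union, mem_settled, Finset.mem_image] at hD
  rcases hD with (⟨i, rfl⟩ | ⟨q, j', rfl⟩ | ⟨q, j', rfl⟩ | ⟨i, i', j', hii, rfl⟩ |
      ⟨i, hi, rfl⟩ | ⟨j', hj', i, hi, rfl⟩) | ⟨i, hi, rfl⟩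
  · simp [mem_totClause, Literal.neg] at hlD
  · refine hpair q.1.1 q.1.2 j' q.2.ne (by simp [mem_injClause]) (by simp [mem_injClause]) ?_
    simpa [mem_injClause, Literal.neg, flies] using hlD
  · simp [Literal.neg, flies, blockInj] at hlD
  · refine hpair i i' j' hii (by simp [pairClause]) (by simp [pairClause]) ?_
    simpa [pairClause, Literal.neg, flies] using hlD
  · simp [Literal.neg] at hlD
  · have : j ≠ j' := fun h => hj (h ▸ hj')
    simp [Literal.neg, flies, this] at hlD
  · have : a j ≠ i := by simpa [eq_comm] using hi
    simp [Literal.neg, flies, this] at hlD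

theorem isCostSRWitness_unblock {a : Fin n → Fin m} (T : Finset (Fin n)) (j : Fin n) :
    IsCostSRWitness (BPHPBlocking m n)
      (settled a Finset.univ ∪ T.image fun j => {(blockTot (a j), false)})
      {(blockTot (a j), false)} (setLit (blockTot (a j), false)) := by
  refine isCostSRWitness_setLit (fun _ => rfl) fun D hD hlD => ?_
  rw [Finset.mem_union, mem_settled, Finset.mem_image] at hD
  rcases hD with (⟨i, rfl⟩ | ⟨q, j', rfl⟩ | ⟨q, j', rfl⟩ | ⟨i, i', j', hii, rfl⟩ |
      ⟨i, hi, rfl⟩ | ⟨j', hj', i, hi, rfl⟩) | ⟨i, hi, rfl⟩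
  · have hi : a j = i := by simpa [mem_totClause, Literal.neg, flies, blockTot] using hlD
    refine ⟨{(flies (a j) j, true)}, Finset.mem_union_left _ (mem_settled.2 ?_), ?_, ?_⟩
    · exact Or.inr (Or.inr (Or.inr (Or.inr (Or.inl ⟨j, Finset.mem_univ _, rfl⟩))))
    · rw [Finset.singleton_subset_iff, mem_totClause, hi]
      exact Or.inr ⟨j, rfl⟩
    · simp [Literal.neg, flies, blockTot]
  · simp [mem_injClause, Literal.neg, blockTot, blockInj] at hlD
  · simp [Literal.neg] at hlD
  · simp [pairClause, Literal.neg] at hlD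
  · simp [Literal.neg, flies, blockTot] at hlD
  · simp [Literal.neg] at hlD
  · simp [Literal.neg] at hlD

end Pigeons

/-! ### Assembling the derivation and bounding its size. -/

section Proof

variable {m n : ℕ}

theorem card_totClause_le (i : Fin m) : (totClause i : Clause (PHPVar m n)).card ≤ n + 1 := by
  refine (Finset.card_insert_le _ _).trans (Nat.succ_le_succ ?_)
  simpa using Finset.card_image_le (s := (Finset.univ : Finset (Fin n)))
    (f := fun j => ((flies i j, true) : Literal (PHPVar m n)))

theorem card_injClause_le (q : {q : Fin m × Fin m // q.1 < q.2}) (j : Fin n) :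
    (injClause q j).card ≤ 3 := Finset.card_le_three

variable (m n) in
theorem card_pairs_le :
    Fintype.card ({q : Fin m × Fin m // q.1 < q.2} × Fin n) ≤ m * m * n := by
  rw [Fintype.card_prod, Fintype.card_fin]
  refine Nat.mul_le_mul_right _ ((Fintype.card_subtype_le _).trans ?_)
  simp

variable (m n) in
theorem card_PHPVar_le : Fintype.card (PHPVar m n) ≤ m * n + m + m * m * n := by
  have := card_pairs_le m n
  simp only [PHPVar, Fintype.card_sum]
  rw [Fintype.card_prod (Fin m)]
  simp only [Fintype.card_fin]
  omega

variable (m n) in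
theorem card_BPHP_le : (BPHP m n).card ≤ m + m * m * n := by
  refine (Finset.card_union_le _ _).trans (add_le_add ?_ ?_)
  · exact Finset.card_image_le.trans (by simp)
  · exact Finset.card_image_le.trans (card_pairs_le m n)

variable (m n) in
theorem reaches_BPHP :
    Reaches (BPHPBlocking m n) (BPHP m n) ((m + m * m * n) * (n + 4)) (BPHP m n) := by
  have h := (reaches_empty (B := BPHPBlocking m n) (Γ := BPHP m n)).family id (BPHP m n)
    (K := n + 4) fun T _ C hC _ s' h' => h'.axiomLine hC (by
      rcases mem_BPHP.1 hC with ⟨i, rfl⟩ | ⟨q, j, rfl⟩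
      · have := card_totClause_le (n := n) i
        omega
      · have := card_injClause_le q j
        omega)
  rw [Finset.image_id, Finset.empty_union, zero_add] at h
  exact h.mono (Nat.mul_le_mul_right _ (card_BPHP_le m n))

variable (m n) in
theorem reaches_injectiveBPHP :
    Reaches (BPHPBlocking m n) (BPHP m n)
      ((m + m * m * n) * (n + 4) + m * m * n * (Fintype.card (PHPVar m n) + 2) + m * m * n * 3)
      (injectiveBPHP m n) := by
  have h1 := (reaches_BPHP m n).family (fun r : {q : Fin m × Fin m // q.1 < q.2} × Fin n =>
    {(blockInj r.1 r.2, false)}) Finset.univ fun T _ r _ hr s' h' =>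
      h'.costSR Finset.subset_union_left (blockInj_mem_cnfVars r.1 r.2)
        (isCostSRWitness_evict T r.1 r.2 hr)
  have h2 := h1.family (fun r : {q : Fin m × Fin m // q.1 < q.2} × Fin n =>
    pairClause r.1.1.1 r.1.1.2 r.2) Finset.univ (K := 3) fun T _ r _ _ s' h' => by
      have hpair : (pairClause r.1.1.1 r.1.1.2 r.2 : Clause (PHPVar m n)) ∪ ∅ =
        pairClause r.1.1.1 r.1.1.2 r.2 := Finset.union_empty _
      rw [← hpair]
      refine h'.resolve (x := blockInj r.1 r.2) (Finset.mem_union_left _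
        (Finset.mem_union_left _ (mem_BPHP.2 (Or.inr ⟨r.1, r.2, ?_⟩))))
        (Finset.mem_union_left _ (Finset.mem_union_right _ ?_)) ?_
      · ext x
        simp only [pairClause, mem_injClause, Finset.mem_insert, Finset.mem_singleton]
        tauto
      · exact Finset.mem_image.2 ⟨r, Finset.mem_univ _, rfl⟩
      · rw [Finset.union_empty]
        exact Nat.succ_le_succ Finset.card_le_two
  refine h2.mono ?_
  rw [Finset.card_univ]
  have := card_pairs_le m n
  gcongr

theorem reaches_settled {a : Fin n → Fin m} (ha : Function.Injective a) {s : ℕ}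
    (h : Reaches (BPHPBlocking m n) (BPHP m n) s (injectiveBPHP m n)) (J : Finset (Fin n)) :
    Reaches (BPHPBlocking m n) (BPHP m n)
      (s + J.card * (m * (Fintype.card (PHPVar m n) + 2))) (settled a J) := by
  induction J using Finset.induction_on with
  | empty => simpa [settled] using h
  | insert j J hj ih =>
    have h1 := ih.family (fun k => {(flies k j, false)}) (Finset.univ.erase (a j))
      fun T hT k hk hkT s' h' =>  by
        have hsub := (BPHP_subset_settled a J).trans
          (Finset.subset_union_left (s₂ := T.image fun k => {(flies k j, false)}))
        by_cases hkJ : ∃ j' ∈ J, k = a j'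
        · obtain ⟨j', hj', rfl⟩ := hkJ
          exact h'.costSR hsub (flies_mem_cnfVars _ _) (isCostSRWitness_occupied hj hj' T)
        · push Not at hkJ
          exact h'.costSR hsub (flies_mem_cnfVars _ _) (isCostSRWitness_exchange ha hj
            (fun hjT => (Finset.mem_erase.1 (hT hjT)).1 rfl) hkT (Finset.mem_erase.1 hk).1 hkJ)
    have h2 := h1.costSR ((BPHP_subset_settled a J).trans Finset.subset_union_left)
      (flies_mem_cnfVars _ _) (isCostSRWitness_occupy hj)
    rw [← settled_insert] at h2
    refine h2.mono (le_of_eq ?_)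
    -- Each hole takes `m` cost-SR lines: `m - 1` excluded pigeons and one occupant.
    have hm : m = (m - 1) + 1 := by have := (a j).pos; omega
    rw [Finset.card_insert_of_notMem hj, Finset.card_erase_of_mem (Finset.mem_univ _),
      Finset.card_univ, Fintype.card_fin]
    generalize Fintype.card (PHPVar m n) = v
    generalize m - 1 = m' at hm
    subst hm
    ring

theorem reaches_unblocked {a : Fin n → Fin m} {s : ℕ}
    (h : Reaches (BPHPBlocking m n) (BPHP m n) s (settled a Finset.univ)) :
    Reaches (BPHPBlocking m n) (BPHP m n) (s + n * (Fintype.card (PHPVar m n) + 2))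
      (settled a Finset.univ ∪ Finset.univ.image fun j => {(blockTot (a j), false)}) := by
  have h1 := h.family (fun j => {(blockTot (a j), false)}) Finset.univ fun T _ j _ _ s' h' =>
    h'.costSR ((BPHP_subset_settled a _).trans Finset.subset_union_left)
      (blockTot_mem_cnfVars _) (isCostSRWitness_unblock T j)
  simpa using h1

/-- A pigeon that occupies no hole is excluded from all `n` holes by units, so `n` resolutions strip
its totality clause down to the blocking variable. -/
theorem reaches_blocked {a : Fin n → Fin m} {s : ℕ} {F : CNF (PHPVar m n)}
    (h : Reaches (BPHPBlocking m n) (BPHP m n) s F) (hF : settled a Finset.univ ⊆ F)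
    (S : Finset (Fin m)) (hS : ∀ i ∈ S, ∀ j, i ≠ a j) :
    ∃ F', F ⊆ F' ∧ (∀ i ∈ S, {(blockTot i, true)} ∈ F') ∧
      Reaches (BPHPBlocking m n) (BPHP m n) (s + S.card * (n * (n + 2))) F' := by
  induction S using Finset.induction_on with
  | empty => exact ⟨F, subset_rfl, by simp, by simpa using h⟩
  | insert i S hi ih =>
    obtain ⟨F₁, h1, h2, h3⟩ := ih fun i' hi' => hS i' (Finset.mem_insert_of_mem hi')
    have hinj : Function.Injective fun j : Fin n => flies i j := fun j j' hj => by
      simpa [flies] using hj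
    have hcard : (Finset.univ.image fun j : Fin n => flies i j).card = n := by
      rw [Finset.card_image_of_injective _ hinj, Finset.card_univ, Fintype.card_fin]
    obtain ⟨F₂, h4, h5, h6⟩ := h3.resolve_units {(blockTot i, true)}
      (Finset.univ.image fun j : Fin n => flies i j) (K := n + 2)
      (by rw [hcard, Finset.card_singleton]; omega)
      (h1 (hF (by
        refine mem_settled.2 (Or.inl ⟨i, ?_⟩)
        rw [Finset.image_image, totClause, Finset.insert_eq]
        rfl)))
      (fun x hx => by
        obtain ⟨j, -, rfl⟩ := Finset.mem_image.1 hx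
        exact h1 (hF (mem_settled.2 (Or.inr (Or.inr (Or.inr (Or.inr (Or.inr
          ⟨j, Finset.mem_univ _, i, hS i (Finset.mem_insert_self _ _) j, rfl⟩))))))))
    refine ⟨F₂, h1.trans h4, fun i' hi' => ?_, ?_⟩
    · rcases Finset.mem_insert.1 hi' with rfl | hi'
      · exact h5
      · exact h4 (h2 i' hi')
    · rw [Finset.card_insert_of_notMem hi, add_mul, one_mul, ← add_assoc]
      rwa [hcard] at h6

theorem proofSize_le {m n v : ℕ} (hnm : n < m) (hv : v ≤ m * n + m + m * m * n) :
    (m + m * m * n) * (n + 4) + m * m * n * (v + 2) + m * m * n * 3 + n * (m * (v + 2)) +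
      n * (v + 2) + m * (n * (n + 2)) ≤ 40 * m ^ 6 := by
  have hm : 1 ≤ m := by omega
  have hn : n ≤ m := hnm.le
  have hp : ∀ k ≤ 6, m ^ k ≤ m ^ 6 := fun k hk => Nat.pow_le_pow_right hm hk
  calc _ ≤ (m + m * m * m) * (m + 4) + m * m * m * ((m * m + m + m * m * m) + 2) +
        m * m * m * 3 + m * (m * ((m * m + m + m * m * m) + 2)) +
        m * ((m * m + m + m * m * m) + 2) + m * (m * (m + 2)) := by
        have hv' : v ≤ m * m + m + m * m * m := hv.trans (by gcongr)
        gcongr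
    -- The coefficients add up to 31, so the constant 40 leaves slack.
    _ = m ^ 6 + 2 * m ^ 5 + 4 * m ^ 4 + 12 * m ^ 3 + 6 * m ^ 2 + 6 * m ^ 1 := by ring
    _ ≤ _ := by
        have h1 := hp 1 (by norm_num)
        have h2 := hp 2 (by norm_num)
        have h3 := hp 3 (by norm_num)
        have h4 := hp 4 (by norm_num)
        have h5 := hp 5 (by norm_num)
        omega

/-- The pigeon that occupies hole `j` in the optimal assignment. -/
def occupant (hnm : n < m) (j : Fin n) : Fin m := ⟨m - n + j, by omega⟩

theorem occupant_injective (hnm : n < m) : Function.Injective (occupant hnm) := fun j j' h => by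
  simpa [occupant, Fin.ext_iff] using h

theorem exists_occupant_eq (hnm : n < m) {i : Fin m} (hi : m - n ≤ i) :
    ∃ j, occupant hnm j = i :=
  ⟨⟨i - (m - n), by omega⟩, Fin.ext (by simp only [occupant]; omega)⟩

theorem card_firstBlocking (hnm : n < m) : (firstBlocking m n).card = m - n := by
  rw [firstBlocking, Finset.card_image_of_injective _ fun i i' h => by simpa [blockTot] using h,
    Fin.card_filter_val_lt]
  omega

theorem blockTot_mem_firstBlocking {i : Fin m} :
    blockTot i ∈ firstBlocking m n ↔ (i : ℕ) < m - n := by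
  simp [firstBlocking, blockTot]

theorem blockInj_notMem_firstBlocking (q : {q : Fin m × Fin m // q.1 < q.2}) (j : Fin n) :
    blockInj q j ∉ firstBlocking m n := by
  simp [firstBlocking, blockTot, blockInj]

theorem firstBlocking_subset : firstBlocking m n ⊆ BPHPBlocking m n := by
  intro b hb
  obtain ⟨i, -, rfl⟩ := Finset.mem_image.1 hb
  exact inr_mem_blocking _

theorem exists_isCostProof (hnm : n < m) :
    ∃ π : List (Line (PHPVar m n)),
      IsCostProof (BPHPBlocking m n) (BPHP m n) (m - n) (firstBlocking m n) π ∧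
      derivationSize π ≤ 40 * m ^ 6 := by
  have h := reaches_unblocked (reaches_settled (occupant_injective hnm)
    (reaches_injectiveBPHP m n) Finset.univ)
  obtain ⟨F, hF, hblock, π, hder, rfl, hsize⟩ := reaches_blocked h Finset.subset_union_left
    (Finset.univ.filter fun i : Fin m => (i : ℕ) < m - n) fun i hi j hij => by
      rw [hij, Finset.mem_filter, occupant] at hi
      simp at hi
  refine ⟨π, ⟨hder, firstBlocking_subset, card_firstBlocking hnm, fun b hb => ?_,
    fun b hb hbS => ?_⟩, hsize.trans ?_⟩
  · obtain ⟨i, hi, rfl⟩ := Finset.mem_image.1 hb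
    exact Or.inr (List.mem_toFinset.1 (hblock i hi))
  · refine Or.inr (List.mem_toFinset.1 (hF ?_))
    rcases Finset.mem_union.1 hb with hb | hb
    · obtain ⟨i, -, rfl⟩ := Finset.mem_image.1 hb
      rw [blockTot_mem_firstBlocking, not_lt] at hbS
      obtain ⟨j, rfl⟩ := exists_occupant_eq hnm hbS
      exact Finset.mem_union_right _ (Finset.mem_image.2 ⟨j, Finset.mem_univ _, rfl⟩)
    · obtain ⟨r, -, rfl⟩ := Finset.mem_image.1 hb
      exact Finset.mem_union_left _ (mem_settled.2 (Or.inr (Or.inr (Or.inl ⟨_, _, rfl⟩))))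
  · refine le_trans ?_ (proofSize_le hnm (card_PHPVar_le m n))
    have hle : (Finset.univ.filter fun i : Fin m => (i : ℕ) < m - n).card ≤ m :=
      (Finset.card_filter_le _ _).trans (by simp)
    rw [Finset.card_univ, Fintype.card_fin]
    gcongr

/-! ### The exact cost. -/

/-- The optimal assignment. -/
def optimal (hnm : n < m) : PHPVar m n → Bool
  | Sum.inl (i, j) => decide (i = occupant hnm j)
  | Sum.inr (Sum.inl i) => decide ((i : ℕ) < m - n)
  | Sum.inr (Sum.inr _) => false

theorem satisfiesCNF_optimal (hnm : n < m) : SatisfiesCNF (optimal hnm) (BPHP m n) := by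
  intro C hC
  rcases mem_BPHP.1 hC with ⟨i, rfl⟩ | ⟨q, j, rfl⟩
  · rcases lt_or_ge (i : ℕ) (m - n) with hi | hi
    · exact ⟨_, mem_totClause.2 (Or.inl rfl), by simp [evalValue, optimal, blockTot, hi]⟩
    · obtain ⟨j, rfl⟩ := exists_occupant_eq hnm hi
      exact ⟨_, mem_totClause.2 (Or.inr ⟨j, rfl⟩), by simp [evalValue, optimal, flies]⟩
  · by_cases h : q.1.1 = occupant hnm j
    · have h' : q.1.2 ≠ occupant hnm j := h ▸ q.2.ne'
      exact ⟨_, mem_injClause.2 (Or.inr (Or.inl rfl)), by simp [evalValue, optimal, flies, h']⟩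
    · exact ⟨_, mem_injClause.2 (Or.inl rfl), by simp [evalValue, optimal, flies, h]⟩

theorem assignCost_optimal (hnm : n < m) :
    assignCost (BPHPBlocking m n) (optimal hnm) = m - n := by
  rw [← card_firstBlocking hnm, assignCost]
  congr 1
  ext b
  rw [Finset.mem_filter]
  rcases b with ⟨i, j⟩ | i | r
  · exact iff_of_false (fun h => flies_notMem_blocking i j h.1)
      fun h => flies_notMem_blocking i j (firstBlocking_subset h)
  · rw [← blockTot, blockTot_mem_firstBlocking]
    simpa [optimal, blockTot] using fun _ => inr_mem_blocking (Sum.inl i)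
  · exact iff_of_false (fun h => by simp [optimal] at h)
      (blockInj_notMem_firstBlocking r.1 r.2)

/-- Charge each pigeon to a hole or to a true blocking variable, injectively. At most `n` pigeons
are charged to holes, so at least `m - n` true blocking variables remain. -/
theorem sub_le_assignCost {α : PHPVar m n → Bool} (hα : SatisfiesCNF α (BPHP m n)) :
    m - n ≤ assignCost (BPHPBlocking m n) α := by
  classical
  have hhole : ∀ i : Fin m, α (blockTot i) = false → ∃ j, α (flies i j) = true := by
    intro i hi
    obtain ⟨x, hx, hxt⟩ := hα _ (mem_BPHP.2 (Or.inl ⟨i, rfl⟩))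
    rcases mem_totClause.1 hx with rfl | ⟨j, rfl⟩
    · simp [evalValue, hi] at hxt
    · exact ⟨j, by simpa [evalValue] using hxt⟩
  choose f hf using hhole
  have hinj : ∀ (q : {q : Fin m × Fin m // q.1 < q.2}) (j : Fin n),
      α (flies q.1.1 j) = true → α (flies q.1.2 j) = true → α (blockInj q j) = true := by
    intro q j h1 h2
    obtain ⟨x, hx, hxt⟩ := hα _ (mem_BPHP.2 (Or.inr ⟨q, j, rfl⟩))
    rcases mem_injClause.1 hx with rfl | rfl | rfl
    · simp [evalValue, h1] at hxt
    · simp [evalValue, h2] at hxt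
    · simpa [evalValue] using hxt
  -- A hole is charged only by the least pigeon that chose it. A later one collides with a smaller
  -- pigeon and is charged to that collision, whose larger index recovers it; this makes the
  -- charging injective.
  let charge : Fin m → Fin n ⊕ PHPVar m n → Prop := fun i => Sum.elim
    (fun j => ∃ hi, f i hi = j ∧ ∀ k hk, k < i → f k hk ≠ j)
    (fun b => α b = true ∧ (b = blockTot i ∨ ∃ q j, q.1.2 = i ∧ b = blockInj q j))
  have hcharge : ∀ i, ∃ c, charge i c := by
    intro i
    by_cases hb : α (blockTot i) = true
    · exact ⟨Sum.inr (blockTot i), hb, Or.inl rfl⟩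
    rw [Bool.not_eq_true] at hb
    by_cases hk : ∃ k hk, k < i ∧ f k hk = f i hb
    · obtain ⟨k, hk, hki, hkf⟩ := hk
      exact ⟨Sum.inr (blockInj ⟨(k, i), hki⟩ (f i hb)),
        hinj _ _ (by rw [← hkf]; exact hf k hk) (hf i hb), Or.inr ⟨_, _, rfl, rfl⟩⟩
    · push Not at hk
      exact ⟨Sum.inl (f i hb), hb, rfl, hk⟩
  choose c hc using hcharge
  have hcinj : Function.Injective c := by
    intro i i' h
    have h1 := hc i
    have h2 := hc i'
    rw [← h] at h2
    rcases hci : c i with j | b <;> rw [hci] at h1 h2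
    · obtain ⟨hi, hij, hmin⟩ := h1
      obtain ⟨hi', hij', hmin'⟩ := h2
      rcases lt_trichotomy i i' with hlt | heq | hlt
      · exact absurd hij (hmin' i hi hlt)
      · exact heq
      · exact absurd hij' (hmin i' hi' hlt)
    · obtain ⟨-, rfl | ⟨q, j, rfl, rfl⟩⟩ := h1 <;>
        obtain ⟨-, h2 | ⟨q', j', rfl, h2⟩⟩ := h2 <;> simp [blockTot, blockInj] at h2
      · exact h2
      · rw [h2.1]
  have hcard := Finset.card_le_card_of_injOn (s := Finset.univ) (t := Finset.univ.disjSum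
    ((BPHPBlocking m n).filter fun b => α b = true)) c (fun i _ => ?_) hcinj.injOn
  · rw [Finset.card_disjSum, Finset.card_univ, Finset.card_univ, Fintype.card_fin,
      Fintype.card_fin] at hcard
    rw [assignCost]
    omega
  · have h1 := hc i
    rcases hci : c i with j | b <;> rw [hci] at h1
    · simp
    · obtain ⟨hb, rfl | ⟨q, j, -, rfl⟩⟩ := h1
      · simpa using ⟨inr_mem_blocking _, hb⟩
      · simpa using ⟨inr_mem_blocking _, hb⟩

theorem hasCost_BPHP (hnm : n < m) : HasCost (BPHPBlocking m n) (BPHP m n) (m - n) := by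
  refine ⟨⟨optimal hnm, satisfiesCNF_optimal hnm, assignCost_optimal hnm⟩, ?_⟩
  rintro _ ⟨α, hα, rfl⟩
  exact sub_le_assignCost hα

end Proof

end CostSR

theorem mainTheorem1 :
    ∃ P : Polynomial ℕ, ∀ m n : ℕ, 1 ≤ n → n < m →
      CostSR.HasCost (CostSR.BPHPBlocking m n) (CostSR.BPHP m n) (m - n) ∧
      ∃ π : List (CostSR.Line (CostSR.PHPVar m n)),
        CostSR.IsCostProof (CostSR.BPHPBlocking m n) (CostSR.BPHP m n) (m - n)
          (CostSR.firstBlocking m n) π ∧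
        CostSR.derivationSize π ≤ P.eval m := by
  refine ⟨40 * Polynomial.X ^ 6, fun m n _ hnm => ⟨CostSR.hasCost_BPHP hnm, ?_⟩⟩
  simpa using CostSR.exists_isCostProof hnm
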